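/- **Theorem 4.1 (localisation of modified needlets).** Let $\mathbb{S}^2\subset\mathbb{R}^3$ be the unit sphere with surface measure $\sigma$, $\sigma(\mathbb{S}^2)=4\pi$, and geodesic distance $d(s,s')=\arccos(s\cdot s')$, and let $P_\ell(x)=\frac{1}{2^\ell \ell!}\frac{d^\ell}{dx^\ell}(x^2-1)^\ell$ be the Legendre polynomials. *Quadrature.* For every $j\in\mathbb{N}_0$ let $n_j\ge 1$, weights $\lambda_{jk}>0$ and nodes $\xi_{jk}\in\mathbb{S}^2$ ($k=1,\dots,n_j$) be given such that $$\int_{\mathbb{S}^2} f\,d\sigma=\sum_{k=1}^{n_j}\lambda_{jk}f(\xi_{jk})\quad\text{for every polynomial } f \text{ of degree at most } 2(2^j-1),$$ and such that, with $h_j=\sup_{s\in\mathbb{S}^2}\min_{k} d(s,\xi_{jk})$ and constants $C_0,c>0$ independent of $j$ and $k$, $$n_j\le C_0\,2^{2j},\qquad \tfrac{h_j}{4}\le h_{j+1}\le\tfrac{h_j}{2},\qquad h_j\le \min_{k\ne k'}d(\xi_{jk},\xi_{jk'}),\qquad \lambda_{jk}\le c\,2^{-2j}.$$ *Cutoff.*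 Let $r>2$ be an integer and let $\kappa\in C^r(\mathbb{R})$ be real-valued with $\operatorname{supp}\kappa=[\frac12,2]$ and $|\kappa(t)|^2+|\kappa(2t)|^2=1$ for $t\in[\frac12,1]$. *Power spectrum.* Let $(A_\ell)_{\ell\ge 0}$ be a sequence of nonnegative reals with $\sum_{\ell\ge 0}(2\ell+1)A_\ell<\infty$. Put $\Delta^0_\ell=\sqrt{A_\ell}$ and $\Delta^i_\ell=\Delta^{i-1}_{\ell+1}-\Delta^{i-1}_\ell$ for $i\ge1$, and assume that for some $\beta>0$ and $c_r>0$ $$|\Delta^r_\ell|\le c_r(1+\ell)^{-(1+\beta+r)}\quad\text{for all }\ell\in\mathbb{N}_0,$$ with the same $r$ as for the cutoff. *Conclusion.* The modified needlets $$\psi^{A}_{jk}(s)=\sqrt{\lambda_{jk}}\sum_{\ell=0}^\infty \kappa\bigl(2^{-j}(2\ell+1)\bigr)\sqrt{A_\ell}\,\frac{2\ell+1}{4\pi}P_\ell(s\cdot\xi_{jk})$$ satisfy, with a constant $C>0$ independent of $j$, $k$ and $s$, $$|\psi^{A}_{jk}(s)|\le\frac{C\,2^{-\beta j}}{1+\bigl(2^j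 d(s,\xi_{jk})\bigr)^r}\qquad\text{for all } j\in\mathbb{N}_0,\ k=1,\dots,n_j,\ s\in\mathbb{S}^2.$$ -/

import Mathlib

noncomputable section

/-- The unit sphere `𝕊²` of Euclidean three-space. -/
abbrev S2 : Type := Metric.sphere (0 : EuclideanSpace ℝ (Fin 3)) 1

/-- The surface measure `σ` on `𝕊²`, of total mass `4π`. -/
def surfaceMeasure : MeasureTheory.Measure S2 :=
  (MeasureTheory.volume : MeasureTheory.Measure (EuclideanSpace ℝ (Fin 3))).toSphere

/-- The Euclidean dot product `s · t` of two points of the sphere. -/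
def sphereDot (s t : S2) : ℝ :=
  inner ℝ (s : EuclideanSpace ℝ (Fin 3)) (t : EuclideanSpace ℝ (Fin 3))

/-- The geodesic distance `d(s, t) = arccos (s · t)` on `𝕊²`. -/
def geodesicDist (s t : S2) : ℝ := Real.arccos (sphereDot s t)

/-- The `ℓ`-th Legendre polynomial, by Rodrigues' formula
`P_ℓ(x) = 1 / (2^ℓ ℓ!) * d^ℓ/dx^ℓ (x² - 1)^ℓ`. -/
def legendreP (ℓ : ℕ) : Polynomial ℝ :=
  Polynomial.C (1 / (2 ^ ℓ * (Nat.factorial ℓ : ℝ))) *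
    Polynomial.derivative^[ℓ] ((Polynomial.X ^ 2 - 1) ^ ℓ)

/-- The mesh norm `h = sup_{s ∈ 𝕊²} min_k d(s, ξ_k)` of a finite family of points. -/
def meshNorm {m : ℕ} (ξ : Fin m → S2) : ℝ := ⨆ s : S2, ⨅ k : Fin m, geodesicDist s (ξ k)

/-- The conditions on the quadratures `Λ_j = {(w_{jk}, ξ_{jk}) : k = 1, …, n_j}`, `j = 0, 1, 2, …`,
with weights `w_{jk}` and nodes `ξ_{jk}`. -/
structure IsNeedletQuadrature (n : ℕ → ℕ) (w : (j : ℕ) → Fin (n j) → ℝ)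
    (ξ : (j : ℕ) → Fin (n j) → S2) : Prop where
  card_pos : ∀ j, 0 < n j
  weight_pos : ∀ j k, 0 < w j k
  /-- Exactness for polynomials of degree at most `2 (2^j - 1)`, restricted to the sphere. -/
  exact : ∀ (j : ℕ) (p : MvPolynomial (Fin 3) ℝ), p.totalDegree ≤ 2 * (2 ^ j - 1) →
    ∫ s : S2, MvPolynomial.eval (fun i => (s : EuclideanSpace ℝ (Fin 3)) i) p ∂surfaceMeasure =
      ∑ k, w j k * MvPolynomial.eval (fun i => (ξ j k : EuclideanSpace ℝ (Fin 3)) i) p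
  card_le : ∃ C : ℝ, 0 < C ∧ ∀ j, (n j : ℝ) ≤ C * 2 ^ (2 * j)
  mesh_lower : ∀ j, meshNorm (ξ j) / 4 ≤ meshNorm (ξ (j + 1))
  mesh_upper : ∀ j, meshNorm (ξ (j + 1)) ≤ meshNorm (ξ j) / 2
  separated : ∀ j k k', k ≠ k' → meshNorm (ξ j) ≤ geodesicDist (ξ j k) (ξ j k')
  weight_le : ∃ c : ℝ, 0 < c ∧ ∀ j k, w j k ≤ c / 2 ^ (2 * j)

/-- The conditions on the cutoff function `κ` of smoothness order `r > 2`. -/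
structure IsNeedletCutoff (r : ℕ) (κ : ℝ → ℝ) : Prop where
  two_lt : 2 < r
  contDiff : ContDiff ℝ r κ
  tsupport_eq : tsupport κ = Set.Icc (1 / 2) 2
  partition : ∀ t ∈ Set.Icc (1 / 2 : ℝ) 1, |κ t| ^ 2 + |κ (2 * t)| ^ 2 = 1

/-- The level-`j` window `b_j(t) = κ(2^{-j} (2t + 1))`. -/
def needletWindow (κ : ℝ → ℝ) (j : ℕ) (t : ℝ) : ℝ := κ ((2 * t + 1) / 2 ^ j)

/-- The kernel `K^A_j(x) = ∑_ℓ b_j(ℓ) √A_ℓ (2ℓ + 1)/(4π) P_ℓ(x)`. The sum is finite when `κ` has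
compact support. -/
def needletKernel (κ : ℝ → ℝ) (A : ℕ → ℝ) (j : ℕ) (x : ℝ) : ℝ :=
  ∑' ℓ : ℕ, needletWindow κ j ℓ * √(A ℓ) * ((2 * ℓ + 1) / (4 * Real.pi)) * (legendreP ℓ).eval x

/-- The modified needlet `ψ^A(s) = √w K^A_j(s · ξ)` of level `j` with quadrature weight `w` and
quadrature node `ξ`. -/
def modifiedNeedlet (κ : ℝ → ℝ) (A : ℕ → ℝ) (j : ℕ) (w : ℝ) (ξ s : S2) : ℝ :=
  √w * needletKernel κ A j (sphereDot s ξ)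

end

/-!
The kernel of the modified needlets of level `j` is `(4π)⁻¹ ∑ a_ℓ (2ℓ + 1) P_ℓ(x)` with coefficients
`a_ℓ = κ(2^{-j}(2ℓ + 1)) √A_ℓ`. These are supported where `1 + ℓ` is comparable to `2^j`, and they
are discrete symbols of order `-(1 + β)` with `r` differences, uniformly in `j`: the window is a
symbol of order `0` by the mean value theorem (`isSymbol_needletWindow`), `√A` is one of order
`-(1 + β)` because it tends to zero and its `r`-th difference decays
(`isSymbol_of_top_fwdDiff`), and products of symbols are symbols (`IsSymbol.mul`).

Localisation is summation by parts against Bonnet's recurrence (`legendreP_recurrence`). It says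
that `(1 - x)(2ℓ + 1) P_ℓ` is the forward difference of `ℓ (P_{ℓ-1} - P_ℓ)`, so multiplication of
the sum by `1 - x` acts on the coefficients as a second-order difference operator `legendreDiff`,
which lowers the order of a symbol by `2`, that is, gains a factor `4^{-j}`. Together with
`|P_ℓ| ≤ 1` this bounds the kernel by `2^{(1 - β) j} (2^j √(1 - x))^{-r}` for even `r`. For odd `r`
one more summation by parts leaves the differences `P_ℓ - P_{ℓ+1}`, which are at most
`4 √(1 - x)` (`abs_legendreP_sub_succ_le`). Both bounds on Legendre polynomials come from the
monotonicity in `ℓ` of the quadratic form `P_{ℓ+1}² - 2x P_{ℓ+1} P_ℓ + P_ℓ²`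
(`legendreP_quadratic_form_le`). The induction on `r` is `legendreSum_localized`.

Finally `√(1 - s · ξ)` controls the geodesic distance from above (`geodesicDist_le`), and the
weights contribute `√w ≤ √c 2^{-j}`.
-/

/-! ### Legendre polynomials -/

namespace NeedletLocalization

open Polynomial

/-- `D^{n+1}(fX) = X D^{n+1}f + (n+1) D^n f` in the Leibniz rule gives the first of the two
relations between consecutive Rodrigues polynomials `D^n (X² - 1)^n`. -/
lemma rodrigues_leibniz (n : ℕ) :
    derivative^[n + 2] ((X ^ 2 - 1 : ℝ[X]) ^ (n + 2)) =
      C (2 * ((n : ℝ) + 2)) * (X * derivative^[n + 1] ((X ^ 2 - 1) ^ (n + 1)) +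
        C ((n : ℝ) + 1) * derivative^[n] ((X ^ 2 - 1) ^ (n + 1))) := by
  have h1 : derivative ((X ^ 2 - 1 : ℝ[X]) ^ (n + 2)) =
      C (2 * ((n : ℝ) + 2)) * ((X ^ 2 - 1) ^ (n + 1) * X) := by
    rw [derivative_pow]
    simp only [derivative_sub, derivative_X_sq, derivative_one, map_mul, map_add, map_natCast,
      map_ofNat, show n + 2 - 1 = n + 1 from rfl]
    push_cast
    ring
  rw [Function.iterate_succ_apply, h1, iterate_derivative_C_mul, iterate_derivative_mul_X]
  simp only [nsmul_eq_mul, Nat.add_sub_cancel, map_add, map_natCast, map_one]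
  push_cast
  ring

/-- Differentiating `(X² - 1)^{n+2}` twice gives the second relation. -/
lemma rodrigues_second_derivative (n : ℕ) :
    derivative^[n + 2] ((X ^ 2 - 1 : ℝ[X]) ^ (n + 2)) =
      C (2 * ((n : ℝ) + 2) * (2 * n + 3)) * derivative^[n] ((X ^ 2 - 1) ^ (n + 1)) +
        C (4 * ((n : ℝ) + 1) * (n + 2)) * derivative^[n] ((X ^ 2 - 1) ^ n) := by
  have h1 : derivative (derivative ((X ^ 2 - 1 : ℝ[X]) ^ (n + 2))) =
      C (2 * ((n : ℝ) + 2) * (2 * n + 3)) * (X ^ 2 - 1) ^ (n + 1) +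
        C (4 * ((n : ℝ) + 1) * (n + 2)) * (X ^ 2 - 1) ^ n := by
    simp only [derivative_sub, derivative_one, derivative_mul, derivative_pow, derivative_X,
      map_mul, map_add, map_natCast, map_one, map_ofNat, derivative_natCast,
      derivative_zero, Nat.add_sub_cancel, show n + 2 - 1 = n + 1 from rfl]
    push_cast
    ring
  rw [Function.iterate_succ_apply, Function.iterate_succ_apply, h1, iterate_map_add,
    iterate_derivative_C_mul, iterate_derivative_C_mul]

lemma legendreP_zero : legendreP 0 = 1 := by simp [legendreP]

lemma legendreP_one : legendreP 1 = X := by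
  have h : C (2⁻¹ : ℝ) * ((1 + 1) * X) = X := by
    rw [← mul_assoc, ← C_1, ← C_add, ← C_mul]
    norm_num
  simp [legendreP, h]

/-- Bonnet's three-term recurrence. -/
lemma legendreP_recurrence (n : ℕ) (x : ℝ) :
    ((n : ℝ) + 2) * (legendreP (n + 2)).eval x =
      (2 * n + 3) * x * (legendreP (n + 1)).eval x - (n + 1) * (legendreP n).eval x := by
  have h1 := congrArg (eval x) (rodrigues_leibniz n)
  have h2 := congrArg (eval x) (rodrigues_second_derivative n)
  simp only [eval_mul, eval_add, eval_C, eval_X] at h1 h2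
  simp only [legendreP, eval_mul, eval_C, Nat.factorial_succ]
  set R0 := eval x (derivative^[n] ((X ^ 2 - 1 : ℝ[X]) ^ n))
  set R1 := eval x (derivative^[n + 1] ((X ^ 2 - 1 : ℝ[X]) ^ (n + 1)))
  set R2 := eval x (derivative^[n + 2] ((X ^ 2 - 1 : ℝ[X]) ^ (n + 2)))
  set V := eval x (derivative^[n] ((X ^ 2 - 1 : ℝ[X]) ^ (n + 1)))
  have hn1 : (n : ℝ) + 1 ≠ 0 := by positivity
  have hn2 : (n : ℝ) + 2 ≠ 0 := by positivity
  have h3 : R2 = 2 * (2 * n + 3) * x * R1 - 4 * (n + 1) ^ 2 * R0 := by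
    apply mul_left_cancel₀ hn2
    linear_combination (2 * (n : ℝ) + 3) * h1 - (n + 1) * h2
  have e1 : (1 : ℝ) / (2 ^ (n + 1) * (((n + 1) * n.factorial : ℕ) : ℝ)) =
      1 / (2 ^ n * (n.factorial : ℝ)) / (2 * (n + 1)) := by
    push_cast
    rw [pow_succ, div_div]
    ring_nf
  have e2 : (1 : ℝ) / (2 ^ (n + 2) * (((n + 1 + 1) * ((n + 1) * n.factorial) : ℕ) : ℝ)) =
      1 / (2 ^ n * (n.factorial : ℝ)) / (4 * (n + 1) * (n + 2)) := by
    push_cast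
    rw [pow_add, div_div]
    ring_nf
  rw [e1, e2]
  generalize (1 : ℝ) / (2 ^ n * (n.factorial : ℝ)) = q
  field_simp
  linear_combination 2 * q * h3

/-- The quadratic form `P_{n+1}² - 2x P_{n+1} P_n + P_n²`, here with the square in `P_{n+1}`
completed, starts at `1 - x²` and does not increase with `n`: by the recurrence, `P_{n+2} - x P_{n+1} = (n+1)/(n+2) * (x P_{n+1} - P_n)`. -/
lemma legendreP_quadratic_form_le (n : ℕ) (x : ℝ) :
    ((legendreP (n + 1)).eval x - x * (legendreP n).eval x) ^ 2 +
      (1 - x ^ 2) * (legendreP n).eval x ^ 2 ≤ 1 - x ^ 2 := by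
  induction n with
  | zero => simp [legendreP_zero, legendreP_one]
  | succ n ih =>
    refine le_trans ?_ ih
    set a := (legendreP n).eval x
    set b := (legendreP (n + 1)).eval x
    have h : (legendreP (n + 2)).eval x - x * b = ((n : ℝ) + 1) / (n + 2) * (x * b - a) := by
      have h2 : (n : ℝ) + 2 ≠ 0 := by positivity
      field_simp
      linear_combination legendreP_recurrence n x
    rw [h, mul_pow]
    have h1 : (((n : ℝ) + 1) / (n + 2)) ^ 2 ≤ 1 := by
      apply pow_le_one₀ (by positivity)
      rw [div_le_one (by positivity)]
      linarith
    nlinarith [mul_le_mul_of_nonneg_right h1 (sq_nonneg (x * b - a))]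

lemma legendreP_eval_one (n : ℕ) : (legendreP n).eval 1 = 1 := by
  suffices h : (legendreP n).eval 1 = 1 ∧ (legendreP (n + 1)).eval 1 = 1 from h.1
  induction n with
  | zero => simp [legendreP_zero, legendreP_one]
  | succ n ih =>
    refine ⟨ih.2, ?_⟩
    have h := legendreP_recurrence n 1
    rw [ih.1, ih.2] at h
    have h2 : (n : ℝ) + 2 ≠ 0 := by positivity
    apply mul_left_cancel₀ h2
    linarith

lemma legendreP_eval_neg_one (n : ℕ) : (legendreP n).eval (-1) = (-1) ^ n := by
  suffices h : (legendreP n).eval (-1) = (-1) ^ n ∧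
    (legendreP (n + 1)).eval (-1) = (-1) ^ (n + 1) from h.1
  induction n with
  | zero => simp [legendreP_zero, legendreP_one]
  | succ n ih =>
    refine ⟨ih.2, ?_⟩
    have h := legendreP_recurrence n (-1)
    rw [ih.1, ih.2] at h
    have h2 : (n : ℝ) + 2 ≠ 0 := by positivity
    apply mul_left_cancel₀ h2
    rw [h]
    ring

lemma abs_legendreP_le_one (n : ℕ) {x : ℝ} (hx : |x| ≤ 1) : |(legendreP n).eval x| ≤ 1 := by
  rcases eq_or_lt_of_le hx with h | h
  · rcases eq_or_eq_neg_of_abs_eq h with rfl | rfl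
    · simp [legendreP_eval_one]
    · simp [legendreP_eval_neg_one]
  · have h1 : 0 < 1 - x ^ 2 := by
      have := (sq_lt_one_iff_abs_lt_one x).2 h
      linarith
    rw [← sq_le_one_iff_abs_le_one]
    nlinarith [legendreP_quadratic_form_le n x,
      sq_nonneg ((legendreP (n + 1)).eval x - x * (legendreP n).eval x)]

/-- Consecutive Legendre polynomials at `cos θ` differ by `O(θ)`, uniformly in the degree. -/
lemma abs_legendreP_sub_succ_le (n : ℕ) {x : ℝ} (hx : |x| ≤ 1) :
    |(legendreP n).eval x - (legendreP (n + 1)).eval x| ≤ 4 * √(1 - x) := by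
  obtain ⟨hx1, hx2⟩ := abs_le.1 hx
  set a := (legendreP n).eval x with ha
  set b := (legendreP (n + 1)).eval x
  have hq : (b - x * a) ^ 2 + (1 - x ^ 2) * a ^ 2 ≤ 1 - x ^ 2 := legendreP_quadratic_form_le n x
  have h0 : 0 ≤ 1 - x := by linarith
  have hs := Real.sq_sqrt h0
  have hs0 := Real.sqrt_nonneg (1 - x)
  have h1 : |b - x * a| ≤ 2 * √(1 - x) := by
    apply abs_le_of_sq_le_sq _ (by positivity)
    nlinarith [mul_nonneg (show 0 ≤ 1 - x ^ 2 by nlinarith) (sq_nonneg a)]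
  have h2 : |(1 - x) * a| ≤ 2 * √(1 - x) := by
    rw [abs_mul, abs_of_nonneg h0]
    have h3 : √(1 - x) ≤ 2 := Real.sqrt_le_iff.2 ⟨by norm_num, by linarith⟩
    have h4 : |a| ≤ 1 := abs_legendreP_le_one n hx
    nlinarith [abs_nonneg a]
  calc |a - b| = |(1 - x) * a - (b - x * a)| := by ring_nf
    _ ≤ |(1 - x) * a| + |b - x * a| := abs_sub _ _
    _ ≤ 4 * √(1 - x) := by linarith

end NeedletLocalization

/-! ### Discrete symbols -/

namespace NeedletLocalization

/-- `IsSymbol k s a` says that the sequences `a j`, `j = 0, 1, 2, …`, are discrete symbols of order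
`s` up to `k` differences: `|Δ^i (a j) ℓ| ≤ C (1 + ℓ)^{s - i}` for `i ≤ k`, with `C` independent
of `j` and `ℓ`. The definition is by recursion on `k`. -/
def IsSymbol : ℕ → ℝ → (ℕ → ℕ → ℝ) → Prop
  | 0, s, a => ∃ C : ℝ, ∀ j ℓ, |a j ℓ| ≤ C * (1 + (ℓ : ℝ)) ^ s
  | k + 1, s, a => (∃ C : ℝ, ∀ j ℓ, |a j ℓ| ≤ C * (1 + (ℓ : ℝ)) ^ s) ∧
      IsSymbol k (s - 1) fun j => fwdDiff 1 (a j)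

/-- The backward shift `(back a) ℓ = a (ℓ - 1)` of a sequence, continued by `(back a) 0 = 0`. -/
def back (a : ℕ → ℝ) : ℕ → ℝ
  | 0 => 0
  | ℓ + 1 => a ℓ

namespace IsSymbol

variable {k : ℕ} {s t : ℝ} {a b : ℕ → ℕ → ℝ}

lemma bound (h : IsSymbol k s a) : ∃ C : ℝ, ∀ j ℓ, |a j ℓ| ≤ C * (1 + (ℓ : ℝ)) ^ s := by
  cases k with
  | zero => exact h
  | succ k => exact h.1

lemma congr (h : IsSymbol k s a) (hab : ∀ j ℓ, a j ℓ = b j ℓ) : IsSymbol k s b := by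
  have : a = b := by ext j ℓ; exact hab j ℓ
  exact this ▸ h

lemma of_succ (h : IsSymbol (k + 1) s a) : IsSymbol k s a := by
  induction k generalizing s a with
  | zero => exact h.1
  | succ k ih => exact ⟨h.1, ih h.2⟩

lemma add (ha : IsSymbol k s a) (hb : IsSymbol k s b) :
    IsSymbol k s fun j ℓ => a j ℓ + b j ℓ := by
  have key : ∀ {s : ℝ} {a b : ℕ → ℕ → ℝ},
      (∃ C : ℝ, ∀ j ℓ, |a j ℓ| ≤ C * (1 + (ℓ : ℝ)) ^ s) →
      (∃ C : ℝ, ∀ j ℓ, |b j ℓ| ≤ C * (1 + (ℓ : ℝ)) ^ s) →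
      ∃ C : ℝ, ∀ j ℓ, |a j ℓ + b j ℓ| ≤ C * (1 + (ℓ : ℝ)) ^ s := by
    rintro s a b ⟨C, hC⟩ ⟨D, hD⟩
    refine ⟨C + D, fun j ℓ => (abs_add_le _ _).trans ?_⟩
    rw [add_mul]
    exact add_le_add (hC j ℓ) (hD j ℓ)
  induction k generalizing s a b with
  | zero => exact key ha hb
  | succ k ih =>
    refine ⟨key ha.1 hb.1, (ih ha.2 hb.2).congr fun j ℓ => ?_⟩
    simp only [fwdDiff]
    ring

/-- A forward shift preserves symbols, since `(2 + ℓ)^s ≤ 2^{|s|} (1 + ℓ)^s`. -/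
lemma shift (h : IsSymbol k s a) : IsSymbol k s fun j ℓ => a j (ℓ + 1) := by
  have key : ∀ {s : ℝ} {a : ℕ → ℕ → ℝ},
      (∃ C : ℝ, ∀ j ℓ, |a j ℓ| ≤ C * (1 + (ℓ : ℝ)) ^ s) →
      ∃ C : ℝ, ∀ j ℓ, |a j (ℓ + 1)| ≤ C * (1 + (ℓ : ℝ)) ^ s := by
    rintro s a ⟨C, hC⟩
    have hC0 : 0 ≤ C := by simpa using (abs_nonneg _).trans (hC 0 0)
    refine ⟨C * 2 ^ |s|, fun j ℓ => (hC j (ℓ + 1)).trans ?_⟩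
    rw [mul_assoc]
    refine mul_le_mul_of_nonneg_left ?_ hC0
    have hl : (0 : ℝ) ≤ ℓ := ℓ.cast_nonneg
    push_cast
    rcases le_total 0 s with hs | hs
    · rw [abs_of_nonneg hs, ← Real.mul_rpow (by norm_num) (by positivity)]
      exact Real.rpow_le_rpow (by positivity) (by linarith) hs
    · calc (1 + ((ℓ : ℝ) + 1)) ^ s ≤ (1 + (ℓ : ℝ)) ^ s :=
            Real.rpow_le_rpow_of_nonpos (by positivity) (by linarith) hs
        _ ≤ 2 ^ |s| * (1 + (ℓ : ℝ)) ^ s :=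
            le_mul_of_one_le_left (by positivity)
              (Real.one_le_rpow (by norm_num) (abs_nonneg s))
  induction k generalizing s a with
  | zero => exact key h
  | succ k ih => exact ⟨key h.1, ih h.2⟩

lemma mul (ha : IsSymbol k s a) (hb : IsSymbol k t b) :
    IsSymbol k (s + t) fun j ℓ => a j ℓ * b j ℓ := by
  have key : ∀ {s t : ℝ} {a b : ℕ → ℕ → ℝ},
      (∃ C : ℝ, ∀ j ℓ, |a j ℓ| ≤ C * (1 + (ℓ : ℝ)) ^ s) →
      (∃ C : ℝ, ∀ j ℓ, |b j ℓ| ≤ C * (1 + (ℓ : ℝ)) ^ t) →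
      ∃ C : ℝ, ∀ j ℓ, |a j ℓ * b j ℓ| ≤ C * (1 + (ℓ : ℝ)) ^ (s + t) := by
    rintro s t a b ⟨C, hC⟩ ⟨D, hD⟩
    refine ⟨C * D, fun j ℓ => ?_⟩
    rw [abs_mul, Real.rpow_add (by positivity)]
    calc |a j ℓ| * |b j ℓ| ≤ (C * (1 + (ℓ : ℝ)) ^ s) * (D * (1 + (ℓ : ℝ)) ^ t) :=
          mul_le_mul (hC j ℓ) (hD j ℓ) (abs_nonneg _) ((abs_nonneg _).trans (hC j ℓ))
      _ = _ := by ring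
  induction k generalizing s t a b with
  | zero => exact key ha hb
  | succ k ih =>
    refine ⟨key ha.1 hb.1, ?_⟩
    have h1 := ih ha.2 hb.of_succ
    have h2 := ih ha.of_succ.shift hb.2
    rw [show s - 1 + t = s + t - 1 by ring] at h1
    rw [show s + (t - 1) = s + t - 1 by ring] at h2
    refine (h1.add h2).congr fun j ℓ => ?_
    simp only [fwdDiff]
    ring

/-- A uniformly bounded family supported at `0` is a symbol of every order. -/
lemma of_supported_zero (C : ℝ) (h0 : ∀ j, |a j 0| ≤ C) (h : ∀ j ℓ, a j (ℓ + 1) = 0) :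
    IsSymbol k s a := by
  have hC : 0 ≤ C := (abs_nonneg _).trans (h0 0)
  have key : ∀ {s : ℝ} {a : ℕ → ℕ → ℝ}, (∀ j, |a j 0| ≤ C) → (∀ j ℓ, a j (ℓ + 1) = 0) →
      ∃ C : ℝ, ∀ j ℓ, |a j ℓ| ≤ C * (1 + (ℓ : ℝ)) ^ s := by
    intro s a h0 h
    refine ⟨C, fun j ℓ => ?_⟩
    cases ℓ with
    | zero => simpa using h0 j
    | succ ℓ =>
      rw [h, abs_zero]
      positivity
  induction k generalizing s a with
  | zero => exact key h0 h
  | succ k ih =>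
    refine ⟨key h0 h, ih (fun j => ?_) fun j ℓ => ?_⟩
    · simpa [fwdDiff, h] using h0 j
    · simp [fwdDiff, h]

lemma const (c : ℝ) : IsSymbol k 0 fun _ _ => c := by
  have key : ∀ {k : ℕ} {s : ℝ}, IsSymbol k s fun _ _ => 0 := fun {k s} =>
    of_supported_zero 0 (by simp) (by simp)
  have h0 : ∃ C : ℝ, ∀ _ ℓ : ℕ, |c| ≤ C * (1 + (ℓ : ℝ)) ^ (0 : ℝ) := ⟨|c|, by simp⟩
  cases k with
  | zero => exact h0
  | succ k => exact ⟨h0, key.congr fun j ℓ => by simp [fwdDiff]⟩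

/-- A backward shift preserves symbols. Its difference is the backward shift of the difference,
apart from a jump at `ℓ = 0`. -/
lemma back (h : IsSymbol k s a) : IsSymbol k s fun j => NeedletLocalization.back (a j) := by
  have key : ∀ {s : ℝ} {a : ℕ → ℕ → ℝ},
      (∃ C : ℝ, ∀ j ℓ, |a j ℓ| ≤ C * (1 + (ℓ : ℝ)) ^ s) →
      ∃ C : ℝ, ∀ j ℓ, |NeedletLocalization.back (a j) ℓ| ≤ C * (1 + (ℓ : ℝ)) ^ s := by
    rintro s a ⟨C, hC⟩
    have hC0 : 0 ≤ C := by simpa using (abs_nonneg _).trans (hC 0 0)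
    refine ⟨C * 2 ^ |s|, fun j ℓ => ?_⟩
    cases ℓ with
    | zero =>
      simp only [NeedletLocalization.back, abs_zero]
      positivity
    | succ ℓ =>
      refine (hC j ℓ).trans ?_
      rw [mul_assoc]
      refine mul_le_mul_of_nonneg_left ?_ hC0
      have hl : (0 : ℝ) ≤ ℓ := ℓ.cast_nonneg
      push_cast
      rcases le_total 0 s with hs | hs
      · calc (1 + (ℓ : ℝ)) ^ s ≤ (1 + ((ℓ : ℝ) + 1)) ^ s :=
              Real.rpow_le_rpow (by positivity) (by linarith) hs
          _ ≤ 2 ^ |s| * (1 + ((ℓ : ℝ) + 1)) ^ s :=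
              le_mul_of_one_le_left (by positivity)
                (Real.one_le_rpow (by norm_num) (abs_nonneg s))
      · have h2 : (2 : ℝ) ^ |s| = (2⁻¹) ^ s := by
          rw [abs_of_nonpos hs, Real.inv_rpow (by norm_num), Real.rpow_neg (by norm_num)]
        rw [h2, ← Real.mul_rpow (by norm_num) (by positivity)]
        exact Real.rpow_le_rpow_of_nonpos (by positivity) (by linarith) hs
  induction k generalizing s a with
  | zero => exact key h
  | succ k ih =>
    refine ⟨key h.1, ?_⟩
    obtain ⟨C, hC⟩ := h.bound
    have hδ : IsSymbol k (s - 1) fun j ℓ => if ℓ = 0 then a j 0 else 0 :=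
      of_supported_zero C (fun j => by simpa using hC j 0) (by simp)
    refine ((ih h.2).add hδ).congr fun j ℓ => ?_
    cases ℓ <;> simp [fwdDiff, NeedletLocalization.back]

/-- The backward difference of a symbol is a symbol of order one less. -/
lemma sub_back (h : IsSymbol (k + 1) s a) :
    IsSymbol k (s - 1) fun j ℓ => a j ℓ - NeedletLocalization.back (a j) ℓ := by
  obtain ⟨C, hC⟩ := h.bound
  have hδ : IsSymbol k (s - 1) fun j ℓ => if ℓ = 0 then a j 0 else 0 :=
    of_supported_zero C (fun j => by simpa using hC j 0) (by simp)
  refine (h.2.back.add hδ).congr fun j ℓ => ?_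
  cases ℓ <;> simp [fwdDiff, NeedletLocalization.back]

lemma id_add_one : IsSymbol k 1 fun _ ℓ => (ℓ : ℝ) + 1 := by
  have h0 : ∃ C : ℝ, ∀ _ ℓ : ℕ, |(ℓ : ℝ) + 1| ≤ C * (1 + (ℓ : ℝ)) ^ (1 : ℝ) := by
    refine ⟨1, fun _ ℓ => ?_⟩
    rw [Real.rpow_one, abs_of_nonneg (by positivity)]
    linarith
  cases k with
  | zero => exact h0
  | succ k =>
    refine ⟨h0, ?_⟩
    rw [sub_self]
    exact (const 1).congr fun j ℓ => by simp [fwdDiff]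

lemma inv_two_mul_add_one : IsSymbol k (-1) fun _ ℓ => (2 * (ℓ : ℝ) + 1)⁻¹ := by
  have h0 : ∃ C : ℝ, ∀ _ ℓ : ℕ, |(2 * (ℓ : ℝ) + 1)⁻¹| ≤ C * (1 + (ℓ : ℝ)) ^ (-1 : ℝ) := by
    refine ⟨1, fun _ ℓ => ?_⟩
    rw [Real.rpow_neg_one, one_mul, abs_of_nonneg (by positivity)]
    refine inv_anti₀ (by positivity) ?_
    have hl : (0 : ℝ) ≤ ℓ := ℓ.cast_nonneg
    linarith
  induction k with
  | zero => exact h0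
  | succ k ih =>
    refine ⟨h0, ?_⟩
    have h := (const (k := k) (-2)).mul (ih.mul ih.shift)
    rw [show (0 : ℝ) + (-1 + -1) = -1 - 1 by norm_num] at h
    refine h.congr fun j ℓ => ?_
    simp only [fwdDiff]
    push_cast
    field_simp
    ring

/-- Bounds on all differences of order `i ≤ k` make a symbol. -/
lemma of_iterate (h : ∀ i ≤ k, ∃ C : ℝ, ∀ j ℓ,
    |(fwdDiff 1)^[i] (a j) ℓ| ≤ C * (1 + (ℓ : ℝ)) ^ (s - i)) : IsSymbol k s a := by
  induction k generalizing s a with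
  | zero => simpa [IsSymbol] using h 0 le_rfl
  | succ k ih =>
    refine ⟨by simpa using h 0 (Nat.zero_le _), ih fun i hi => ?_⟩
    obtain ⟨C, hC⟩ := h (i + 1) (by omega)
    refine ⟨C, fun j ℓ => ?_⟩
    have := hC j ℓ
    rwa [Function.iterate_succ_apply, show s - ((i + 1 : ℕ) : ℝ) = s - 1 - i by push_cast; ring]
      at this

end IsSymbol

/-- If a sequence tends to zero and its difference is `O((1+ℓ)^{-(p+1)})`, then it is
`O((1+ℓ)^{-p})`: convexity makes `|g ℓ| - C' (1+ℓ)^{-p}` nondecreasing for a suitable `C'`, and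
its limit is `0`. -/
lemma decay_of_fwdDiff {g : ℕ → ℝ} {p C : ℝ} (hp : 0 < p)
    (hg : Filter.Tendsto g Filter.atTop (nhds 0))
    (h : ∀ ℓ, |fwdDiff 1 g ℓ| ≤ C * (1 + (ℓ : ℝ)) ^ (-p - 1)) :
    ∃ C' : ℝ, ∀ ℓ, |g ℓ| ≤ C' * (1 + (ℓ : ℝ)) ^ (-p) := by
  have hC0 : 0 ≤ C := by simpa using (abs_nonneg _).trans (h 0)
  -- The gain of `y^{-p}` over a unit step, from `log ((y + 1) / y) ≥ 1 / (y + 1)`.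
  have conv : ∀ y : ℝ, 1 ≤ y → p / 2 * y ^ (-p - 1) ≤ 2 ^ p * (y ^ (-p) - (y + 1) ^ (-p)) := by
    intro y hy
    have hy0 : 0 < y := by linarith
    have e1 : 1 + p / (y + 1) ≤ ((y + 1) / y) ^ p := by
      have hlog : 1 / (y + 1) ≤ Real.log ((y + 1) / y) := by
        have := Real.one_sub_inv_le_log_of_pos (show 0 < (y + 1) / y by positivity)
        refine le_trans (le_of_eq ?_) this
        field_simp
        ring
      rw [Real.rpow_def_of_pos (by positivity)]
      have := Real.add_one_le_exp (Real.log ((y + 1) / y) * p)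
      have h3 := mul_le_mul_of_nonneg_right hlog hp.le
      rw [show p / (y + 1) = 1 / (y + 1) * p by ring]
      linarith
    have e2 : p / (2 * y) ≤ p / (y + 1) :=
      div_le_div_of_nonneg_left hp.le (by positivity) (by linarith)
    have e3 : y ^ (-p - 1) = y ^ (-p) / y := by rw [Real.rpow_sub_one hy0.ne']
    have e4 : ((y + 1) / y) ^ p * (y + 1) ^ (-p) = y ^ (-p) := by
      rw [Real.div_rpow (by positivity) hy0.le, Real.rpow_neg (by positivity),
        Real.rpow_neg hy0.le]
      have : (y + 1) ^ p ≠ 0 := by positivity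
      field_simp
    have e5 : y ^ (-p) ≤ 2 ^ p * (y + 1) ^ (-p) := by
      rw [Real.rpow_neg hy0.le, Real.rpow_neg (by positivity : 0 ≤ y + 1), ← div_eq_mul_inv,
        inv_eq_one_div, div_le_div_iff₀ (by positivity) (by positivity), one_mul,
        ← Real.mul_rpow (by norm_num) hy0.le]
      exact Real.rpow_le_rpow (by positivity) (by linarith) hp.le
    calc p / 2 * y ^ (-p - 1) = p / (2 * y) * y ^ (-p) := by rw [e3]; field_simp
      _ ≤ p / (y + 1) * (2 ^ p * (y + 1) ^ (-p)) := by gcongr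
      _ = 2 ^ p * (p / (y + 1) * (y + 1) ^ (-p)) := by ring
      _ ≤ 2 ^ p * ((((y + 1) / y) ^ p - 1) * (y + 1) ^ (-p)) := by gcongr; linarith
      _ = 2 ^ p * (y ^ (-p) - (y + 1) ^ (-p)) := by rw [sub_mul, e4, one_mul]
  set C' := 2 * C / p * 2 ^ p with hC'
  refine ⟨C', fun ℓ => ?_⟩
  have hmono : Monotone fun ℓ : ℕ => |g ℓ| - C' * (1 + (ℓ : ℝ)) ^ (-p) := by
    refine monotone_nat_of_le_succ fun ℓ => ?_
    have h1 := conv (1 + ℓ) (by linarith [ℓ.cast_nonneg (α := ℝ)])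
    have h2 : C * (1 + (ℓ : ℝ)) ^ (-p - 1) ≤
        C' * ((1 + (ℓ : ℝ)) ^ (-p) - (1 + (ℓ : ℝ) + 1) ^ (-p)) := by
      have := mul_le_mul_of_nonneg_left h1 (show 0 ≤ 2 * C / p by positivity)
      calc _ = 2 * C / p * (p / 2 * (1 + (ℓ : ℝ)) ^ (-p - 1)) := by field_simp
        _ ≤ _ := this
        _ = _ := by rw [hC']; ring
    have h3 : |g ℓ| ≤ |g (ℓ + 1)| + |fwdDiff 1 g ℓ| := by
      have := abs_sub (g (ℓ + 1)) (fwdDiff 1 g ℓ)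
      simpa [fwdDiff] using this
    have h4 := h ℓ
    push_cast
    rw [← add_assoc]
    nlinarith
  have hlim : Filter.Tendsto (fun ℓ : ℕ => |g ℓ| - C' * (1 + (ℓ : ℝ)) ^ (-p)) Filter.atTop
      (nhds 0) := by
    have h1 : Filter.Tendsto (fun ℓ : ℕ => (1 + (ℓ : ℝ)) ^ (-p)) Filter.atTop (nhds 0) :=
      (tendsto_rpow_neg_atTop hp).comp
        (Filter.tendsto_atTop_add_const_left _ _ tendsto_natCast_atTop_atTop)
    simpa using hg.abs.sub (h1.const_mul C')
  linarith [hmono.ge_of_tendsto hlim ℓ]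

/-- For a sequence tending to zero, decay of the `k`-th difference alone makes it a symbol of
negative order. -/
lemma isSymbol_of_top_fwdDiff {k : ℕ} {g : ℕ → ℝ} {p C : ℝ} (hp : 0 < p)
    (hg : Filter.Tendsto g Filter.atTop (nhds 0))
    (h : ∀ ℓ, |(fwdDiff 1)^[k] g ℓ| ≤ C * (1 + (ℓ : ℝ)) ^ (-(p + k))) :
    IsSymbol k (-p) fun _ => g := by
  induction k generalizing p g with
  | zero => exact ⟨C, fun _ ℓ => by simpa using h ℓ⟩
  | succ k ih =>
    have hΔ : Filter.Tendsto (fwdDiff 1 g) Filter.atTop (nhds 0) := by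
      have := (hg.comp (Filter.tendsto_add_atTop_nat 1)).sub hg
      rw [sub_zero] at this
      exact this
    have h1 : IsSymbol k (-(p + 1)) fun _ => fwdDiff 1 g := by
      refine ih (by linarith) hΔ fun ℓ => ?_
      have := h ℓ
      rwa [Function.iterate_succ_apply, show -(p + ((k + 1 : ℕ) : ℝ)) = -(p + 1 + k) by
        push_cast; ring] at this
    rw [show -(p + 1) = -p - 1 by ring] at h1
    obtain ⟨D, hD⟩ := h1.bound
    obtain ⟨C', hC'⟩ := decay_of_fwdDiff hp hg (hD 0)
    exact ⟨⟨C', fun _ => hC'⟩, h1⟩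

end NeedletLocalization

/-! ### Localisation of Legendre sums -/

namespace NeedletLocalization

open Filter Finset

/-- The family of sequences `a j` is supported where `1 + ℓ` is comparable to `2^j`. -/
def IsDyadic (a : ℕ → ℕ → ℝ) : Prop :=
  ∃ K : ℕ, ∀ j ℓ, a j ℓ ≠ 0 → 2 ^ j ≤ K * (1 + ℓ) ∧ 1 + ℓ ≤ K * 2 ^ j

namespace IsDyadic

variable {a b : ℕ → ℕ → ℝ}

lemma mono (h : IsDyadic a) (hab : ∀ j ℓ, a j ℓ = 0 → b j ℓ = 0) : IsDyadic b := by
  obtain ⟨K, hK⟩ := h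
  exact ⟨K, fun j ℓ hb => hK j ℓ fun ha => hb (hab j ℓ ha)⟩

lemma sub (ha : IsDyadic a) (hb : IsDyadic b) : IsDyadic fun j ℓ => a j ℓ - b j ℓ := by
  obtain ⟨K, hK⟩ := ha
  obtain ⟨L, hL⟩ := hb
  refine ⟨K + L, fun j ℓ h => ?_⟩
  have h' : a j ℓ ≠ 0 ∨ b j ℓ ≠ 0 := by
    by_contra! h0
    exact h (by simp [h0])
  rw [add_mul, add_mul]
  rcases h' with h' | h'
  · have := hK j ℓ h'
    exact ⟨le_add_right this.1, le_add_right this.2⟩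
  · have := hL j ℓ h'
    exact ⟨le_add_left this.1, le_add_left this.2⟩

lemma shift (h : IsDyadic a) : IsDyadic fun j ℓ => a j (ℓ + 1) := by
  obtain ⟨K, hK⟩ := h
  refine ⟨2 * K, fun j ℓ h => ?_⟩
  obtain ⟨h1, h2⟩ := hK j (ℓ + 1) h
  constructor <;> nlinarith

lemma back (h : IsDyadic a) : IsDyadic fun j => NeedletLocalization.back (a j) := by
  obtain ⟨K, hK⟩ := h
  refine ⟨2 * K, fun j ℓ h => ?_⟩
  cases ℓ with
  | zero => exact absurd rfl h
  | succ ℓ =>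
    obtain ⟨h1, h2⟩ := hK j ℓ h
    constructor <;> nlinarith

lemma fwdDiff (h : IsDyadic a) : IsDyadic fun j => _root_.fwdDiff 1 (a j) := h.shift.sub h

lemma eventually_zero (h : IsDyadic a) (j : ℕ) : ∀ᶠ ℓ in atTop, a j ℓ = 0 := by
  obtain ⟨K, hK⟩ := h
  filter_upwards [eventually_ge_atTop (K * 2 ^ j)] with ℓ hℓ
  by_contra h0
  have := (hK j ℓ h0).2
  omega

/-- A dyadically supported symbol of order `s` has `ℓ¹`-norm `O(2^{j(s+1)})`. -/
lemma sum_abs_le (h : IsDyadic a) {s : ℝ}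
    (hs : ∃ C : ℝ, ∀ j ℓ, |a j ℓ| ≤ C * (1 + (ℓ : ℝ)) ^ s) :
    ∃ C : ℝ, ∀ j M, ∑ ℓ ∈ range M, |a j ℓ| ≤ C * ((2 : ℝ) ^ j) ^ (s + 1) := by
  obtain ⟨K, hK⟩ := h
  obtain ⟨C, hC⟩ := hs
  have hC0 : 0 ≤ C := by simpa using (abs_nonneg _).trans (hC 0 0)
  set L : ℝ := (K : ℝ) ^ |s| with hL
  refine ⟨K * (C * L), fun j M => ?_⟩
  have hN : (0 : ℝ) < 2 ^ j := by positivity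
  have hterm : ∀ ℓ, |a j ℓ| ≤ C * L * ((2 : ℝ) ^ j) ^ s := by
    intro ℓ
    by_cases h0 : a j ℓ = 0
    · rw [h0, abs_zero]
      positivity
    obtain ⟨h1, h2⟩ := hK j ℓ h0
    have h1' : (2 : ℝ) ^ j ≤ K * (1 + ℓ) := by exact_mod_cast h1
    have h2' : 1 + (ℓ : ℝ) ≤ K * 2 ^ j := by exact_mod_cast h2
    refine (hC j ℓ).trans ?_
    rw [mul_assoc]
    refine mul_le_mul_of_nonneg_left ?_ hC0
    have hl : (0 : ℝ) < 1 + ℓ := by positivity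
    have hK0 : (0 : ℝ) < K := by
      by_contra! hK1
      nlinarith
    rcases le_total 0 s with hs | hs
    · rw [hL, abs_of_nonneg hs, ← Real.mul_rpow hK0.le hN.le]
      exact Real.rpow_le_rpow hl.le h2' hs
    · have h3 : L = (K : ℝ)⁻¹ ^ s := by
        rw [hL, abs_of_nonpos hs, Real.inv_rpow hK0.le, Real.rpow_neg hK0.le]
      rw [h3, ← Real.mul_rpow (by positivity) hN.le]
      refine Real.rpow_le_rpow_of_nonpos (by positivity) ?_ hs
      rw [inv_mul_le_iff₀ hK0]
      exact h1'
  calc ∑ ℓ ∈ range M, |a j ℓ| ≤ ∑ ℓ ∈ range (K * 2 ^ j), |a j ℓ| := by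
        have hzero : ∀ ℓ ∈ range (max M (K * 2 ^ j)), ℓ ∉ range (K * 2 ^ j) → |a j ℓ| = 0 := by
          intro ℓ _ hℓ
          by_contra h0
          have := (hK j ℓ (abs_ne_zero.1 h0)).2
          rw [mem_range] at hℓ
          omega
        rw [sum_subset (range_mono (le_max_right M _)) hzero]
        exact sum_le_sum_of_subset_of_nonneg (range_mono (le_max_left M _))
          fun _ _ _ => abs_nonneg _
    _ ≤ ∑ _ℓ ∈ range (K * 2 ^ j), C * L * ((2 : ℝ) ^ j) ^ s := sum_le_sum fun ℓ _ => hterm ℓ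
    _ = K * (C * L) * ((2 : ℝ) ^ j) ^ (s + 1) := by
        rw [sum_const, card_range, nsmul_eq_mul, Real.rpow_add_one hN.ne']
        push_cast
        ring

end IsDyadic

/-- The partial sums `∑_{ℓ < M} a_ℓ (2ℓ + 1) P_ℓ(x)`. -/
noncomputable def legendreSum (a : ℕ → ℝ) (M : ℕ) (x : ℝ) : ℝ :=
  ∑ ℓ ∈ range M, a ℓ * (2 * ℓ + 1) * (legendreP ℓ).eval x

/-- The coefficients `c_ℓ = -(ℓ + 1) (a_{ℓ+1} - a_ℓ)` of `(1 - x) ∑ a_ℓ (2ℓ + 1) P_ℓ` with respect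
to the differences `P_ℓ - P_{ℓ+1}`. -/
def diffCoeff (a : ℕ → ℝ) (ℓ : ℕ) : ℝ := -1 * (((ℓ : ℝ) + 1) * fwdDiff 1 a ℓ)

/-- The second-order difference operator on coefficients that corresponds to multiplication of
`∑ a_ℓ (2ℓ + 1) P_ℓ(x)` by `1 - x`. -/
noncomputable def legendreDiff (a : ℕ → ℝ) (ℓ : ℕ) : ℝ :=
  (2 * (ℓ : ℝ) + 1)⁻¹ * (diffCoeff a ℓ - back (diffCoeff a) ℓ)

/-- Summation by parts: Bonnet's recurrence makes `(1 - x) (2ℓ + 1) P_ℓ` the forward difference of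
`ℓ (P_{ℓ-1} - P_ℓ)`. -/
lemma one_sub_mul_legendreSum (a : ℕ → ℝ) (M : ℕ) (x : ℝ) :
    (1 - x) * legendreSum a (M + 1) x =
      ∑ ℓ ∈ range (M + 1), diffCoeff a ℓ * ((legendreP ℓ).eval x - (legendreP (ℓ + 1)).eval x) +
        a (M + 1) * ((M + 1) * ((legendreP M).eval x - (legendreP (M + 1)).eval x)) := by
  induction M with
  | zero =>
    simp [legendreSum, diffCoeff, legendreP_zero, legendreP_one, fwdDiff]
    ring
  | succ M ih =>
    rw [legendreSum, sum_range_succ, mul_add, ← legendreSum, ih, sum_range_succ _ (M + 1)]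
    simp only [diffCoeff, fwdDiff]
    push_cast
    linear_combination a (M + 1) * legendreP_recurrence M x

lemma sum_mul_sub_succ (c p : ℕ → ℝ) (M : ℕ) :
    ∑ ℓ ∈ range M, c ℓ * (p ℓ - p (ℓ + 1)) =
      ∑ ℓ ∈ range M, (c ℓ - back c ℓ) * p ℓ - back c M * p M := by
  induction M with
  | zero => simp [back]
  | succ M ih =>
    rw [sum_range_succ, ih, sum_range_succ]
    simp only [back]
    ring

lemma one_sub_mul_legendreSum_eq_sum_diffCoeff {a : ℕ → ℝ} (ha : ∀ᶠ ℓ in atTop, a ℓ = 0) (x : ℝ) :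
    ∀ᶠ M in atTop, (1 - x) * legendreSum a M x =
      ∑ ℓ ∈ range M, diffCoeff a ℓ * ((legendreP ℓ).eval x - (legendreP (ℓ + 1)).eval x) := by
  filter_upwards [ha, eventually_ge_atTop 1] with M hM hM1
  obtain ⟨M, rfl⟩ : ∃ m, M = m + 1 := ⟨M - 1, by omega⟩
  rw [one_sub_mul_legendreSum, hM]
  ring

lemma one_sub_mul_legendreSum_eq_legendreSum_legendreDiff {a : ℕ → ℝ}
    (ha : ∀ᶠ ℓ in atTop, a ℓ = 0) (x : ℝ) :
    ∀ᶠ M in atTop, (1 - x) * legendreSum a M x = legendreSum (legendreDiff a) M x := by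
  obtain ⟨L, hL⟩ := eventually_atTop.1 ha
  filter_upwards [one_sub_mul_legendreSum_eq_sum_diffCoeff ha x,
    eventually_ge_atTop (L + 1)] with M hM hM1
  obtain ⟨M, rfl⟩ : ∃ m, M = m + 1 := ⟨M - 1, by omega⟩
  have h0 : diffCoeff a M = 0 := by
    simp [diffCoeff, fwdDiff, hL M (by omega), hL (M + 1) (by omega)]
  rw [hM, sum_mul_sub_succ _ fun ℓ => (legendreP ℓ).eval x, legendreSum]
  rw [show back (diffCoeff a) (M + 1) = 0 from h0, zero_mul, sub_zero]
  refine sum_congr rfl fun ℓ _ => ?_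
  have : 2 * (ℓ : ℝ) + 1 ≠ 0 := by positivity
  rw [legendreDiff]
  field_simp

variable {k : ℕ} {s : ℝ} {a : ℕ → ℕ → ℝ}

lemma IsSymbol.diffCoeff (h : IsSymbol (k + 1) s a) :
    IsSymbol k s fun j => NeedletLocalization.diffCoeff (a j) := by
  have h1 := (IsSymbol.const (-1)).mul (IsSymbol.id_add_one.mul h.2)
  rwa [show (0 : ℝ) + (1 + (s - 1)) = s by ring] at h1

lemma IsSymbol.legendreDiff (h : IsSymbol (k + 2) s a) :
    IsSymbol k (s - 2) fun j => NeedletLocalization.legendreDiff (a j) := by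
  have h1 := IsSymbol.inv_two_mul_add_one.mul h.diffCoeff.sub_back
  rwa [show (-1 : ℝ) + (s - 1) = s - 2 by ring] at h1

lemma IsDyadic.diffCoeff (h : IsDyadic a) :
    IsDyadic fun j => NeedletLocalization.diffCoeff (a j) :=
  h.fwdDiff.mono fun j ℓ h0 => by simp [NeedletLocalization.diffCoeff, h0]

lemma IsDyadic.legendreDiff (h : IsDyadic a) :
    IsDyadic fun j => NeedletLocalization.legendreDiff (a j) :=
  (h.diffCoeff.sub h.diffCoeff.back).mono fun j ℓ h0 => by
    simp [NeedletLocalization.legendreDiff, h0]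

/-- Localisation of Legendre sums whose coefficients form a dyadically supported symbol with `r`
differences: every factor `1 - x` costs two differences and gains `4^{-j}`. For odd `r` the
remaining factor `√(1 - x)` comes from `P_ℓ - P_{ℓ+1} = O(√(1 - x))`. -/
theorem legendreSum_localized (r : ℕ) {s : ℝ} {a : ℕ → ℕ → ℝ} (ha : IsSymbol r s a)
    (hd : IsDyadic a) :
    ∃ C : ℝ, ∀ j x, |x| ≤ 1 → ∀ᶠ M in atTop,
      √(1 - x) ^ r * |legendreSum (a j) M x| ≤ C * ((2 : ℝ) ^ j) ^ (s + 2 - r) := by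
  induction r using Nat.twoStepInduction generalizing s a with
  | zero =>
    obtain ⟨C, hC⟩ := (hd.mono (b := fun j ℓ => a j ℓ * (2 * ((ℓ : ℝ) + 1)))
      fun j ℓ h => by simp [h]).sum_abs_le
        (ha.mul ((IsSymbol.const 2).mul IsSymbol.id_add_one)).bound
    refine ⟨C, fun j x hx => Eventually.of_forall fun M => ?_⟩
    have := hC j M
    rw [show s + (0 + 1) + 1 = s + 2 - (0 : ℕ) by push_cast; ring] at this
    rw [pow_zero, one_mul]
    refine le_trans ?_ this
    refine (abs_sum_le_sum_abs _ _).trans (sum_le_sum fun ℓ _ => ?_)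
    rw [abs_mul, abs_mul, abs_mul]
    have h1 := abs_legendreP_le_one ℓ hx
    have h2 : |2 * (ℓ : ℝ) + 1| ≤ |2 * ((ℓ : ℝ) + 1)| := by
      rw [abs_of_nonneg (by positivity), abs_of_nonneg (by positivity)]
      linarith
    calc |a j ℓ| * |2 * (ℓ : ℝ) + 1| * |(legendreP ℓ).eval x|
        ≤ |a j ℓ| * |2 * ((ℓ : ℝ) + 1)| * 1 := by gcongr
      _ = _ := mul_one _
  | one =>
    obtain ⟨C, hC⟩ := hd.diffCoeff.sum_abs_le ha.diffCoeff.bound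
    refine ⟨4 * C, fun j x hx => ?_⟩
    filter_upwards [one_sub_mul_legendreSum_eq_sum_diffCoeff (hd.eventually_zero j) x] with M hM
    have hx0 : 0 ≤ 1 - x := by linarith [(abs_le.1 hx).2]
    have hs : s + 2 - (1 : ℕ) = s + 1 := by push_cast; ring
    rw [hs, pow_one]
    have h1 : (1 - x) * |legendreSum (a j) M x| ≤
        √(1 - x) * (4 * C * ((2 : ℝ) ^ j) ^ (s + 1)) := by
      rw [← abs_of_nonneg hx0, ← abs_mul, abs_of_nonneg hx0, hM]
      calc _ ≤ ∑ ℓ ∈ range M, |diffCoeff (a j) ℓ| * (4 * √(1 - x)) := by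
            refine (abs_sum_le_sum_abs _ _).trans (sum_le_sum fun ℓ _ => ?_)
            rw [abs_mul]
            exact mul_le_mul_of_nonneg_left (abs_legendreP_sub_succ_le ℓ hx) (abs_nonneg _)
        _ = 4 * √(1 - x) * ∑ ℓ ∈ range M, |diffCoeff (a j) ℓ| := by rw [← sum_mul, mul_comm]
        _ ≤ 4 * √(1 - x) * (C * ((2 : ℝ) ^ j) ^ (s + 1)) :=
            mul_le_mul_of_nonneg_left (hC j M) (by positivity)
        _ = _ := by ring
    rcases hx0.eq_or_lt with h0 | h0
    · rw [← h0, Real.sqrt_zero, zero_mul, mul_assoc]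
      exact mul_nonneg (by norm_num) ((sum_nonneg fun _ _ => abs_nonneg _).trans (hC j M))
    · refine le_of_mul_le_mul_left ?_ (Real.sqrt_pos.2 h0)
      rwa [← mul_assoc, Real.mul_self_sqrt hx0]
  | more r ih _ =>
    obtain ⟨C, hC⟩ := ih ha.legendreDiff hd.legendreDiff
    refine ⟨C, fun j x hx => ?_⟩
    filter_upwards [hC j x hx,
      one_sub_mul_legendreSum_eq_legendreSum_legendreDiff (hd.eventually_zero j) x] with M h1 h2
    have hx0 : 0 ≤ 1 - x := by linarith [(abs_le.1 hx).2]
    rw [← h2, abs_mul, abs_of_nonneg hx0, ← mul_assoc] at h1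
    rw [pow_add, Real.sq_sqrt hx0]
    rwa [show s - 2 + 2 - (r : ℝ) = s + 2 - ((r + 2 : ℕ) : ℝ) by push_cast; ring] at h1

end NeedletLocalization

/-! ### The needlet window -/

namespace NeedletLocalization

open Filter Finset

lemma hasDerivAt_fwdDiff_iterate {f : ℝ → ℝ} (h : ℝ) (hf : ContDiff ℝ 1 f) (i : ℕ) (x : ℝ) :
    HasDerivAt ((fwdDiff h)^[i] f) ((fwdDiff h)^[i] (deriv f) x) x := by
  induction i generalizing x with
  | zero => exact (hf.differentiable one_ne_zero x).hasDerivAt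
  | succ i ih =>
    rw [Function.iterate_succ_apply', Function.iterate_succ_apply']
    exact ((ih (x + h)).comp_add_const x h).sub (ih x)

/-- The mean value theorem for differences of order `i`. -/
lemma abs_fwdDiff_iterate_le {i : ℕ} {f : ℝ → ℝ} {B h : ℝ} (hh : 0 ≤ h) (hf : ContDiff ℝ i f)
    (hB : ∀ x, |iteratedDeriv i f x| ≤ B) (x : ℝ) : |(fwdDiff h)^[i] f x| ≤ h ^ i * B := by
  induction i generalizing f x with
  | zero => simpa using hB x
  | succ i ih =>
    have hf1 : ContDiff ℝ 1 f := hf.of_le (by exact_mod_cast Nat.le_add_left 1 i)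
    have hf' : ContDiff ℝ i (deriv f) := by
      have : ContDiff ℝ ((i : WithTop ℕ∞) + 1) f := by exact_mod_cast hf
      exact (contDiff_succ_iff_deriv.1 this).2.2
    have hbound : ∀ y, ‖(fwdDiff h)^[i] (deriv f) y‖ ≤ h ^ i * B := fun y =>
      ih hf' (fun z => by rw [← iteratedDeriv_succ']; exact hB z) y
    have := convex_univ.norm_image_sub_le_of_norm_hasDerivWithin_le
      (fun y _ => (hasDerivAt_fwdDiff_iterate h hf1 i y).hasDerivWithinAt) (fun y _ => hbound y)
      (Set.mem_univ x) (Set.mem_univ (x + h))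
    rw [Function.iterate_succ_apply', fwdDiff]
    refine this.trans (le_of_eq ?_)
    rw [add_sub_cancel_left, Real.norm_of_nonneg hh]
    ring

lemma fwdDiff_iterate_needletWindow (κ : ℝ → ℝ) (j i ℓ : ℕ) :
    (fwdDiff 1)^[i] (fun ℓ : ℕ => needletWindow κ j ℓ) ℓ =
      (fwdDiff ((2 : ℝ) / 2 ^ j))^[i] κ ((2 * ℓ + 1) / 2 ^ j) := by
  induction i generalizing ℓ with
  | zero => rfl
  | succ i ih =>
    rw [Function.iterate_succ_apply', Function.iterate_succ_apply', fwdDiff, fwdDiff, ih, ih,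
      show (2 * ((ℓ + 1 : ℕ) : ℝ) + 1) / 2 ^ j = (2 * ℓ + 1) / 2 ^ j + 2 / 2 ^ j by
        push_cast; ring]

lemma fwdDiff_iterate_eq_zero {f : ℝ → ℝ} {c h : ℝ} (hh : 0 ≤ h) (hf : ∀ x, c < x → f x = 0)
    (i : ℕ) {x : ℝ} (hx : c < x) : (fwdDiff h)^[i] f x = 0 := by
  induction i generalizing x with
  | zero => exact hf x hx
  | succ i ih =>
    rw [Function.iterate_succ_apply', fwdDiff, ih hx, ih (by linarith), sub_zero]

/-- The windows are symbols of order `0`, uniformly in the level: their `i`-th differences are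
`O(2^{-ij})` and vanish for `ℓ > 2^j`. -/
lemma isSymbol_needletWindow {r : ℕ} {κ : ℝ → ℝ} (hκ : IsNeedletCutoff r κ) :
    IsSymbol r 0 fun j ℓ => needletWindow κ j ℓ := by
  have hcomp : HasCompactSupport κ := by
    rw [HasCompactSupport, hκ.tsupport_eq]
    exact isCompact_Icc
  have hzero : ∀ x, 2 < x → κ x = 0 := fun x hx => by
    refine image_eq_zero_of_notMem_tsupport ?_
    rw [hκ.tsupport_eq]
    exact fun h => absurd h.2 (not_le.2 hx)
  refine IsSymbol.of_iterate fun i hi => ?_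
  have hi' : (i : WithTop ℕ∞) ≤ r := by exact_mod_cast hi
  obtain ⟨B, hB⟩ : ∃ B, ∀ x, |iteratedDeriv i κ x| ≤ B := by
    have hc : HasCompactSupport (iteratedDeriv i κ) := by
      have := hcomp.iteratedFDeriv (𝕜 := ℝ) i
      rw [iteratedDeriv_eq_equiv_comp]
      exact this.comp_left (by simp)
    exact hc.exists_bound_of_continuous (hκ.contDiff.continuous_iteratedDeriv i hi')
  have hB0 : 0 ≤ B := (abs_nonneg _).trans (hB 0)
  refine ⟨4 ^ i * B, fun j ℓ => ?_⟩
  rw [fwdDiff_iterate_needletWindow, zero_sub, Real.rpow_neg (by positivity), Real.rpow_natCast]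
  have hN : (1 : ℝ) ≤ 2 ^ j := one_le_pow₀ (by norm_num)
  by_cases hℓ : (ℓ : ℝ) ≤ 2 ^ j
  · refine (abs_fwdDiff_iterate_le (by positivity) (hκ.contDiff.of_le hi') hB _).trans ?_
    rw [mul_right_comm, ← inv_pow, ← mul_pow]
    refine mul_le_mul_of_nonneg_right (pow_le_pow_left₀ (by positivity) ?_ i) hB0
    rw [← div_eq_mul_inv, div_le_div_iff₀ (by positivity) (by positivity)]
    linarith
  · rw [fwdDiff_iterate_eq_zero (by positivity) hzero, abs_zero]
    · positivity
    · rw [lt_div_iff₀ (by positivity)]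
      linarith

lemma isDyadic_needletWindow {r : ℕ} {κ : ℝ → ℝ} (hκ : IsNeedletCutoff r κ) :
    IsDyadic fun j ℓ => needletWindow κ j ℓ := by
  refine ⟨4, fun j ℓ h => ?_⟩
  have hmem : (2 * (ℓ : ℝ) + 1) / 2 ^ j ∈ tsupport κ := subset_tsupport _ h
  rw [hκ.tsupport_eq, Set.mem_Icc, le_div_iff₀ (by positivity), div_le_iff₀ (by positivity)] at hmem
  have h1 : 2 ^ j ≤ 2 * (2 * ℓ + 1) := by
    have : (2 : ℝ) ^ j ≤ 2 * (2 * ℓ + 1) := by linarith [hmem.1]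
    exact_mod_cast this
  have h2 : 2 * ℓ + 1 ≤ 2 * 2 ^ j := by exact_mod_cast hmem.2
  have h3 : 1 ≤ 2 ^ j := Nat.one_le_two_pow
  omega

/-! ### Localisation of the needlets -/

lemma tendsto_sqrt_of_summable {A : ℕ → ℝ} (hA : ∀ ℓ, 0 ≤ A ℓ)
    (hsum : Summable fun ℓ : ℕ => (2 * (ℓ : ℝ) + 1) * A ℓ) :
    Tendsto (fun ℓ => √(A ℓ)) atTop (nhds 0) := by
  have h : Tendsto A atTop (nhds 0) := by
    refine squeeze_zero hA (fun ℓ => ?_) hsum.tendsto_atTop_zero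
    exact le_mul_of_one_le_left (hA ℓ) (by linarith [ℓ.cast_nonneg (α := ℝ)])
  simpa using h.sqrt

/-- The product of the window and `√A` is supported in finitely many degrees, so the series for the
kernel is a finite Legendre sum. -/
lemma eventually_needletKernel_eq {κ : ℝ → ℝ} {A : ℕ → ℝ} {j : ℕ}
    (h : ∀ᶠ ℓ : ℕ in atTop, needletWindow κ j ℓ * √(A ℓ) = 0) (x : ℝ) :
    ∀ᶠ M in atTop, needletKernel κ A j x =
      (4 * Real.pi)⁻¹ * legendreSum (fun ℓ => needletWindow κ j ℓ * √(A ℓ)) M x := by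
  obtain ⟨L, hL⟩ := eventually_atTop.1 h
  filter_upwards [eventually_ge_atTop L] with M hM
  rw [needletKernel, tsum_eq_sum (s := range M), legendreSum, mul_sum]
  · refine sum_congr rfl fun ℓ _ => ?_
    field_simp
  · intro ℓ hℓ
    rw [mem_range, not_lt] at hℓ
    rw [hL ℓ (hM.trans hℓ), zero_mul, zero_mul]

/-- The kernel localises to the order `q` up to which both the windows and `√A` are symbols. The
case `q = 0` is the uniform bound near the node. -/
lemma needletKernel_localized {κ : ℝ → ℝ} {A : ℕ → ℝ} {p : ℝ} {q : ℕ}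
    (hκ : IsSymbol q 0 fun j ℓ => needletWindow κ j ℓ)
    (hκd : IsDyadic fun j ℓ => needletWindow κ j ℓ)
    (hA : IsSymbol q (-p) fun _ ℓ => √(A ℓ)) :
    ∃ C : ℝ, ∀ j x, |x| ≤ 1 →
      √(1 - x) ^ q * |needletKernel κ A j x| ≤ C * ((2 : ℝ) ^ j) ^ (2 - p - q) := by
  have hd : IsDyadic fun j ℓ => needletWindow κ j ℓ * √(A ℓ) :=
    hκd.mono fun j ℓ h => by rw [h, zero_mul]
  obtain ⟨C, hC⟩ := legendreSum_localized q (hκ.mul hA) hd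
  refine ⟨(4 * Real.pi)⁻¹ * C, fun j x hx => ?_⟩
  obtain ⟨M, h1, h2⟩ :=
    ((hC j x hx).and (eventually_needletKernel_eq (hd.eventually_zero j) x)).exists
  have hπ : 0 < (4 * Real.pi)⁻¹ := by positivity
  rw [h2, abs_mul, abs_of_pos hπ, mul_left_comm, mul_assoc]
  refine mul_le_mul_of_nonneg_left (h1.trans (le_of_eq ?_)) hπ.le
  congr 2
  ring

lemma abs_sphereDot_le_one (s t : S2) : |sphereDot s t| ≤ 1 := by
  have := abs_real_inner_le_norm (s : EuclideanSpace ℝ (Fin 3)) (t : EuclideanSpace ℝ (Fin 3))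
  simpa [sphereDot] using this

/-- The geodesic distance is controlled by `√(1 - s · t)`, a multiple of the chordal distance. -/
lemma geodesicDist_le (s t : S2) : geodesicDist s t ≤ Real.pi * √(1 - sphereDot s t) := by
  obtain ⟨h1, h2⟩ := abs_le.1 (abs_sphereDot_le_one s t)
  have h := Real.cos_le_one_sub_mul_cos_sq (x := geodesicDist s t) (by
    rw [geodesicDist, abs_of_nonneg (Real.arccos_nonneg _)]
    exact Real.arccos_le_pi _)
  rw [geodesicDist, Real.cos_arccos h1 h2, ← geodesicDist] at h
  have h0 : 0 ≤ 1 - sphereDot s t := by linarith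
  refine le_of_abs_le (abs_le_of_sq_le_sq ?_ (by positivity))
  rw [mul_pow, Real.sq_sqrt h0]
  have h3 : 2 / Real.pi ^ 2 * geodesicDist s t ^ 2 ≤ 1 - sphereDot s t := by linarith
  rw [div_mul_eq_mul_div, div_le_iff₀ (by positivity)] at h3
  nlinarith [sq_nonneg (geodesicDist s t)]

end NeedletLocalization

open NeedletLocalization in
theorem theorem4p1 (n : ℕ → ℕ) (w : (j : ℕ) → Fin (n j) → ℝ) (ξ : (j : ℕ) → Fin (n j) → S2)
    (hquad : IsNeedletQuadrature n w ξ)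
    (r : ℕ) (κ : ℝ → ℝ) (hκ : IsNeedletCutoff r κ)
    (A : ℕ → ℝ) (hA : ∀ ℓ, 0 ≤ A ℓ) (hsum : Summable fun ℓ : ℕ => (2 * (ℓ : ℝ) + 1) * A ℓ)
    (β : ℝ) (hβ : 0 < β) (cr : ℝ) (hcr : 0 < cr)
    (hdiff : ∀ ℓ : ℕ,
      |(fwdDiff 1)^[r] (fun i : ℕ => √(A i)) ℓ| ≤ cr * (1 + (ℓ : ℝ)) ^ (-(1 + β + (r : ℝ)))) :
    ∃ C : ℝ, 0 < C ∧ ∀ (j : ℕ) (k : Fin (n j)) (s : S2),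
      |modifiedNeedlet κ A j (w j k) (ξ j k) s| ≤
        C * (2 : ℝ) ^ (-(β * (j : ℝ))) / (1 + (2 ^ j * geodesicDist s (ξ j k)) ^ r) := by
  have hAs : IsSymbol r (-(1 + β)) fun _ ℓ => √(A ℓ) :=
    isSymbol_of_top_fwdDiff (by linarith) (tendsto_sqrt_of_summable hA hsum) hdiff
  have hκs := isSymbol_needletWindow hκ
  have hκd := isDyadic_needletWindow hκ
  obtain ⟨C₀, hC₀⟩ := needletKernel_localized (q := 0) hκs.bound hκd hAs.bound
  obtain ⟨C₁, hC₁⟩ := needletKernel_localized hκs hκd hAs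
  obtain ⟨c, hc, hw⟩ := hquad.weight_le
  have hCC₀ : 0 ≤ C₀ := by
    have := hC₀ 0 0 (by simp)
    simp only [pow_zero, one_mul, Real.one_rpow, mul_one] at this
    exact (abs_nonneg _).trans this
  have hCC₁ : 0 ≤ C₁ := by
    have := hC₁ 0 0 (by simp)
    simp only [pow_zero, sub_zero, Real.sqrt_one, one_pow, one_mul, Real.one_rpow, mul_one] at this
    exact (abs_nonneg _).trans this
  -- The summand `1` makes the constant positive even for a vanishing spectrum.
  refine ⟨√c * (C₀ + Real.pi ^ r * C₁) + 1, by positivity, fun j k s => ?_⟩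
  have hx := abs_sphereDot_le_one s (ξ j k)
  set x := sphereDot s (ξ j k) with hxdef
  set d := geodesicDist s (ξ j k) with hd
  have hd0 : 0 ≤ d := Real.arccos_nonneg _
  have hN : (0 : ℝ) < 2 ^ j := by positivity
  set N : ℝ := 2 ^ j with hNdef
  have hweight : √(w j k) ≤ √c / N := by
    refine (Real.sqrt_le_sqrt (hw j k)).trans (le_of_eq ?_)
    rw [mul_comm 2 j, pow_mul, ← hNdef, Real.sqrt_div hc.le, Real.sqrt_sq hN.le]
  have hβN : N * (2 : ℝ) ^ (-(β * (j : ℝ))) = N ^ (2 - (1 + β)) := by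
    rw [show 2 - (1 + β) = 1 + -β by ring, Real.rpow_add hN, Real.rpow_one, hNdef,
      ← Real.rpow_natCast, ← Real.rpow_mul (by norm_num)]
    congr 2
    ring
  have hK₀ : |needletKernel κ A j x| ≤ C₀ * (N * (2 : ℝ) ^ (-(β * (j : ℝ)))) := by
    have := hC₀ j x hx
    rwa [pow_zero, one_mul, Nat.cast_zero, sub_zero, ← hNdef, ← hβN] at this
  have hK₁ : (N * d) ^ r * |needletKernel κ A j x| ≤
      Real.pi ^ r * C₁ * (N * (2 : ℝ) ^ (-(β * (j : ℝ)))) := by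
    calc (N * d) ^ r * |needletKernel κ A j x|
        ≤ (N * (Real.pi * √(1 - x))) ^ r * |needletKernel κ A j x| := by
          gcongr
          exact geodesicDist_le s (ξ j k)
      _ = N ^ r * Real.pi ^ r * (√(1 - x) ^ r * |needletKernel κ A j x|) := by ring
      _ ≤ N ^ r * Real.pi ^ r * (C₁ * N ^ (2 - (1 + β) - r)) := by
          exact mul_le_mul_of_nonneg_left (hC₁ j x hx) (by positivity)
      _ = Real.pi ^ r * C₁ * (N * (2 : ℝ) ^ (-(β * (j : ℝ)))) := by
          rw [Real.rpow_sub hN, Real.rpow_natCast, hβN]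
          field_simp
  rw [modifiedNeedlet, ← hxdef, abs_mul, abs_of_nonneg (Real.sqrt_nonneg _),
    le_div_iff₀ (by positivity)]
  have hE : (0 : ℝ) < 2 ^ (-(β * (j : ℝ))) := by positivity
  set E : ℝ := 2 ^ (-(β * (j : ℝ)))
  calc √(w j k) * |needletKernel κ A j x| * (1 + (N * d) ^ r)
      = √(w j k) * (|needletKernel κ A j x| + (N * d) ^ r * |needletKernel κ A j x|) := by ring
    _ ≤ √c / N * (C₀ * (N * E) + Real.pi ^ r * C₁ * (N * E)) := by gcongr
    _ = √c * (C₀ + Real.pi ^ r * C₁) * E := by field_simp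
    _ ≤ (√c * (C₀ + Real.pi ^ r * C₁) + 1) * E := by gcongr; linarith
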